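/- Let $(X,Y)\overset{d}{=}R(\cos\Theta,\sin\Theta)$, where $R>0$ almost surely, $\Theta$ is uniformly distributed on $(-\pi,\pi)$, and $R$ and $\Theta$ are independent. Let $F$ be the distribution function of $R$ and $\bar F=1-F$. Assume that $F$ has right endpoint $\sup\{x:F(x)<1\}=1$ and lies in the Weibull max-domain of attraction with index $\alpha>0$, that is, $$\lim_{t\downarrow 0}\frac{\bar F(1-tx)}{\bar F(1-t)}=x^{\alpha}\qquad\text{for all }x>0.$$ Put $$\mathcal I_\alpha=\frac{\sqrt2}{\pi}\int_0^1(1-s^2)^\alpha\,ds,\qquad \Upsilon_\alpha(t)=\frac{\int_{-1}^t(1-s^2)^\alpha\,ds}{\int_{-1}^1(1-s^2)^\alpha\,ds}\quad(-1\le t\le 1),$$ with $\Upsilon_\alpha(t)=0$ for $t<-1$ and $\Upsilon_\alpha(t)=1$ for $t>1$. Let $\rho_n\in(0,1]$ and $u_n>0$ $(n\ge1)$ be such that $u_n\to0$ and $$\lim_{n\to\infty}\frac{1-\rho_n}{u_n}=2\lambda^2\quad\text{for some }\lambda\in[0,\infty).$$ (a) For every $x<0$, $$\lim_{n\to\infty}\frac{P\bigl(\rho_n|X|+\sqrt{1-\rho_n^2}\,Y>1+u_nx\bigr)}{u_n^{1/2}\,\bar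 F(1-u_n)}=2\,\mathcal I_\alpha\,|x|^{1/2+\alpha}.$$ (b) Suppose moreover that $u_n^{1/2}\bar F(1-u_n)\sim 1/n$ as $n\to\infty$. Let $(X_{jn},Z_{jn})$, $1\le j\le n$, $n\ge1$, be a triangular array of random vectors such that, for each $n$, the vectors $(X_{1n},Z_{1n}),\dots,(X_{nn},Z_{nn})$ are independent and each has the distribution of $(X,\ \rho_n|X|+\sqrt{1-\rho_n^2}\,Y)$. Then, for all $x,y<0$, $$\lim_{n\to\infty}P\Bigl(\frac{\max_{j\le n}X_{jn}-1}{u_n}\le x,\ \frac{\max_{j\le n}Z_{jn}-1}{u_n}\le y\Bigr)=\exp\Bigl(-\mathcal I_\alpha\bigl(|x|^{1/2+\alpha}\,\Upsilon_{\alpha,\lambda}(x,y)+|y|^{1/2+\alpha}\,(1+\Upsilon_{\alpha,\lambda}(y,x))\bigr)\Bigr),$$ where, for $\lambda>0$, $$\Upsilon_{\alpha,\lambda}(x,y)=\Upsilon_\alpha\Bigl(\frac{\lambda+(y-x)/(2\lambda)}{\sqrt{2|x|}}\Bigr),$$ and for $\lambda=0$ this is read as its limit for $\lambda\downarrow0$: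 $\Upsilon_{\alpha,0}(x,y)$ equals $1$ if $x<y$, $0$ if $x>y$, and $1/2$ if $x=y$. -/

import Mathlib

open MeasureTheory ProbabilityTheory Filter Topology Asymptotics

noncomputable section

namespace HalfSkew

/-- `(X, Y)` has the same law as `R (cos Θ, sin Θ)`, where the radius `R` is almost surely
positive, the angle `Θ` is uniform on `(-π, π)`, and `R` and `Θ` are independent.
The pair `(X, Y)` and the pair `(R, Θ)` may live on different probability spaces. -/
structure IsPolarPair {Ω Ω' : Type*} [MeasurableSpace Ω] [MeasurableSpace Ω']
    (X Y : Ω → ℝ) (P : Measure Ω) (R Θ : Ω' → ℝ) (P' : Measure Ω') : Prop where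
  aemeasurable_radius : AEMeasurable R P'
  radius_pos : ∀ᵐ ω ∂P', 0 < R ω
  angle_uniform : pdf.IsUniform Θ (Set.Ioo (-Real.pi) Real.pi) P'
  indep : IndepFun R Θ P'
  identDistrib : IdentDistrib (fun ω => (X ω, Y ω))
    (fun ω => (R ω * Real.cos (Θ ω), R ω * Real.sin (Θ ω))) P P'

/-- The distribution function `F` has right endpoint `sup {x | F x < 1} = 1` and lies in the
Weibull max-domain of attraction with index `α`. -/
structure IsWeibullMDA (F : ℝ → ℝ) (α : ℝ) : Prop where
  endpoint : IsLUB {x : ℝ | F x < 1} 1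
  tail : ∀ x : ℝ, 0 < x →
    Tendsto (fun t : ℝ => (1 - F (1 - t * x)) / (1 - F (1 - t))) (𝓝[>] 0) (𝓝 (x ^ α))

/-- The constant `I_α = (√2 / π) ∫₀¹ (1 - s²)^α ds`. -/
def constI (α : ℝ) : ℝ :=
  √2 / Real.pi * ∫ s in (0 : ℝ)..1, (1 - s ^ 2) ^ α

/-- The distribution function `Υ_α` on the whole line: for `t ∈ [-1, 1]` it is
`∫_{-1}^t (1 - s²)^α ds / ∫_{-1}^1 (1 - s²)^α ds`, it is `0` for `t ≤ -1` and `1` for `t ≥ 1`. -/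
def upsilon (α t : ℝ) : ℝ :=
  (∫ s in (-1 : ℝ)..(max (-1) (min 1 t)), (1 - s ^ 2) ^ α) /
    ∫ s in (-1 : ℝ)..1, (1 - s ^ 2) ^ α

/-- `Υ_α ((λ + (y - x) / (2λ)) / √(2|x|))` for `λ > 0`; for `λ = 0` it is the limit of this
quantity as `λ ↓ 0`, i.e. `1` if `x < y`, `0` if `y < x`, and `Υ_α 0 = 1/2` if `x = y`. -/
def upsilonTerm (α lam x y : ℝ) : ℝ :=
  if lam = 0 then
    if x < y then 1 else if y < x then 0 else 1 / 2
  else upsilon α ((lam + (y - x) / (2 * lam)) / √(2 * |x|))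

/-- The limiting joint distribution function, for `x, y < 0`. -/
def limitDF (α lam x y : ℝ) : ℝ :=
  Real.exp (-(constI α *
    (|x| ^ (1 / 2 + α) * upsilonTerm α lam x y +
      |y| ^ (1 / 2 + α) * (1 + upsilonTerm α lam y x))))

/-- The skew combination `ρ|x| + √(1 - ρ²) y`. -/
def skew (ρ x y : ℝ) : ℝ := ρ * |x| + √(1 - ρ ^ 2) * y

/-- A half-skew triangular array: for each `n ≥ 1` the pairs `(X_{jn}, Z_{jn})`, `j = 1, …, n`
(indexed here by `Fin n`), are independent, and each has the law of
`(X, ρ_n |X| + √(1 - ρ_n²) Y)`. -/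
structure IsHalfSkewArray {Ω Ω' : Type*} [MeasurableSpace Ω] [MeasurableSpace Ω']
    (Xa Za : (n : ℕ) → Fin n → Ω' → ℝ) (Q : Measure Ω')
    (X Y : Ω → ℝ) (P : Measure Ω) (ρ : ℕ → ℝ) : Prop where
  indep : ∀ n, iIndepFun (fun (j : Fin n) ω => (Xa n j ω, Za n j ω)) Q
  identDistrib : ∀ n, ∀ j : Fin n, IdentDistrib (fun ω => (Xa n j ω, Za n j ω))
    (fun ω => (X ω, skew (ρ n) (X ω) (Y ω))) Q P

end HalfSkew

end

/-! Given the angle, each exceedance event is a ray in the radius, so every probability is an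
angular integral of one-dimensional radial tails. With `ψ = arccos ρ`, the skew component at angle
`θ` in the right half-plane is `R cos (θ - ψ)`. Reflecting the left half-plane onto the right leaves
it unchanged and makes `X` nonpositive there.

A level `1 - u v` is exceeded only at angles within order `√u` of the maximising direction. Under `θ
= √u t`, `R ≤ 1` and regular variation turn the tail at `θ - ψ`, divided by the radial tail at `1 -
u`, into `(v - (t - 2λ)² / 2)₊ ^ α`, since `ψ / √u → 2λ`. Dominated convergence
(`exists_cosTail_bound`, `tendsto_integral_max_cosTail`) passes this to the integral.

In the right half-plane the two rays in a given direction are nested, so a union of exceedances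
contributes the maximum of two parabola profiles; the left half-plane contributes the skew profile
alone. The parabolas cross at most once if `λ > 0`, and splitting there yields the `Υ` terms
(`integral_max_parabola`). Independence and `(1 - p_n)^n → exp (-lim n p_n)` finish part (b). -/

/-! ### Radial tail and regular variation. -/

/-- A probability law on `(0, 1]` whose tail at the right endpoint `1` is regularly varying. -/
structure WeibullLaw (μ : Measure ℝ) (α : ℝ) : Prop where
  pos : ∀ᵐ r ∂μ, 0 < r
  le_one : ∀ᵐ r ∂μ, r ≤ 1
  tail_pos : ∀ t : ℝ, 0 < t → 0 < μ.real (Set.Ioi (1 - t))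
  tail : ∀ x : ℝ, 0 < x →
    Tendsto (fun t : ℝ => μ.real (Set.Ioi (1 - t * x)) / μ.real (Set.Ioi (1 - t)))
      (𝓝[>] 0) (𝓝 (x ^ α))

theorem weibullLaw_map {Ω : Type*} [MeasurableSpace Ω] {P : Measure Ω} [IsProbabilityMeasure P]
    {R : Ω → ℝ} (hR : AEMeasurable R P) (hpos : ∀ᵐ ω ∂P, 0 < R ω) {α : ℝ}
    (h : HalfSkew.IsWeibullMDA (fun x => cdf (P.map R) x) α) :
    WeibullLaw (P.map R) α ∧
      ∀ x, 1 - cdf (P.map R) x = (P.map R).real (Set.Ioi x) := by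
  have : IsProbabilityMeasure (P.map R) := Measure.isProbabilityMeasure_map hR
  have key : ∀ x, 1 - cdf (P.map R) x = (P.map R).real (Set.Ioi x) := fun x => by
    rw [cdf_eq_real, ← Set.compl_Iic, probReal_compl_eq_one_sub measurableSet_Iic]
  refine ⟨⟨?_, ?_, ?_, ?_⟩, key⟩
  · rw [ae_map_iff hR measurableSet_Ioi]
    exact hpos
  -- The endpoint forces the distribution function to be `1` to the right of `1`; right continuity
  -- extends this to `1` itself.
  · have h1 : cdf (P.map R) 1 = 1 := by
      have hc := (cdf (P.map R)).right_continuous 1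
      have hc' : Tendsto (cdf (P.map R)) (𝓝[>] 1) (𝓝 (cdf (P.map R) 1)) :=
        hc.tendsto.mono_left (nhdsWithin_mono _ Set.Ioi_subset_Ici_self)
      refine tendsto_nhds_unique hc' (tendsto_const_nhds.congr' ?_)
      filter_upwards [self_mem_nhdsWithin] with x hx
      refine le_antisymm ?_ (cdf_le_one _ _)
      by_contra hlt
      exact absurd (h.endpoint.1 (not_le.1 hlt)) (not_le.2 hx)
    have h2 := key 1
    rw [h1, sub_self, eq_comm, measureReal_eq_zero_iff] at h2
    simpa [ae_iff, Set.Ioi] using h2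
  · intro t ht
    rw [← key]
    obtain ⟨y, hy, hy1, -⟩ := h.endpoint.exists_between (show 1 - t < 1 by linarith)
    have := monotone_cdf (P.map R) hy1.le
    have hy' : cdf (P.map R) y < 1 := hy
    linarith
  · intro x hx
    simp_rw [← key]
    exact h.tail x hx

/-- Monotonicity of the tail upgrades regular variation at a fixed argument to a convergent one: `c
n` is trapped against constants near `c₀`, and `x₊ ^ α` is continuous because `α > 0`. Nonpositive
`c₀` is included, which handles directions outside the limiting support. -/
theorem tendsto_max_rpow_div {μ : Measure ℝ} [IsProbabilityMeasure μ] {α : ℝ} (hα : 0 < α)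
    (hμ : WeibullLaw μ α) {u c : ℕ → ℝ} {c₀ : ℝ} (hu : Tendsto u atTop (𝓝[>] 0))
    (hc : Tendsto c atTop (𝓝 c₀)) :
    Tendsto (fun n => μ.real (Set.Ioi (1 - u n * c n)) / μ.real (Set.Ioi (1 - u n)))
      atTop (𝓝 (max c₀ 0 ^ α)) := by
  have hupos : ∀ᶠ n in atTop, 0 < u n := hu.eventually self_mem_nhdsWithin
  have upper : ∀ a, max c₀ 0 < a → ∀ᶠ n in atTop,
      μ.real (Set.Ioi (1 - u n * c n)) / μ.real (Set.Ioi (1 - u n)) ≤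
      μ.real (Set.Ioi (1 - u n * a)) / μ.real (Set.Ioi (1 - u n)) := by
    intro a ha
    filter_upwards [hupos, hc.eventually_lt_const ((le_max_left _ _).trans_lt ha)] with n hn h
    have := mul_le_mul_of_nonneg_left h.le hn.le
    gcongr ?_ / _
    exact measureReal_mono (Set.Ioi_subset_Ioi (by linarith))
  have cont : Continuous fun x : ℝ => max x 0 ^ α :=
    (continuous_id.max continuous_const).rpow_const fun _ => Or.inr hα.le
  refine tendsto_order.2 ⟨fun b hb => ?_, fun b hb => ?_⟩
  · rcases le_or_gt c₀ 0 with h0 | h0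
    · rw [max_eq_right h0, Real.zero_rpow hα.ne'] at hb
      exact Eventually.of_forall fun n => hb.trans_le (by positivity)
    · have : ∀ᶠ a in 𝓝[<] c₀, b < max a 0 ^ α ∧ 0 < a ∧ a < c₀ :=
        ((cont.tendsto c₀).mono_left nhdsWithin_le_nhds |>.eventually_const_lt hb).and
          (((tendsto_id.mono_left nhdsWithin_le_nhds).eventually_const_lt h0).and
            self_mem_nhdsWithin)
      obtain ⟨a, ha, ha0, hac⟩ := this.exists
      rw [max_eq_left ha0.le] at ha
      filter_upwards [hupos, hc.eventually_const_lt hac,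
        ((hμ.tail a ha0).comp hu).eventually_const_lt ha] with n hn h h'
      refine h'.trans_le ?_
      have := mul_le_mul_of_nonneg_left h.le hn.le
      dsimp only [Function.comp]
      gcongr ?_ / _
      exact measureReal_mono (Set.Ioi_subset_Ioi (by linarith))
  · have cont' : Tendsto (fun x : ℝ => max x 0 ^ α) (𝓝[>] (max c₀ 0)) (𝓝 (max c₀ 0 ^ α)) := by
      have := (cont.tendsto (max c₀ 0)).mono_left (nhdsWithin_le_nhds (s := Set.Ioi (max c₀ 0)))
      simpa [Function.comp_def] using this
    obtain ⟨a, ha, hac⟩ := ((cont'.eventually_lt_const hb).and self_mem_nhdsWithin).exists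
    have ha0 : 0 < a := (le_max_right _ _).trans_lt hac
    rw [max_eq_left ha0.le] at ha
    filter_upwards [upper a hac, ((hμ.tail a ha0).comp hu).eventually_lt_const ha] with n h h'
    exact h.trans_lt h'

/-! ### Small-angle asymptotics. -/

theorem mul_sinc (x : ℝ) : x * Real.sinc x = Real.sin x := by
  rcases eq_or_ne x 0 with rfl | hx
  · simp
  · rw [Real.sinc_of_ne_zero hx, mul_div_cancel₀ _ hx]

/-- An exact half-angle identity: continuity of `sinc` at `0` then replaces any Taylor remainder. -/
theorem one_sub_cos_eq (x : ℝ) : 1 - Real.cos x = x ^ 2 / 2 * Real.sinc (x / 2) ^ 2 := by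
  have h := mul_sinc (x / 2)
  have h2 := Real.cos_sq' (x / 2)
  have h3 := Real.cos_sq (x / 2)
  rw [mul_div_cancel₀ _ (two_ne_zero)] at h3
  rw [show x ^ 2 / 2 * Real.sinc (x / 2) ^ 2 = 2 * (x / 2 * Real.sinc (x / 2)) ^ 2 by ring, h]
  linarith

/-- `(1 - cos φ_n) / u_n → τ² / 2` when `φ_n / √u_n → τ`. -/
theorem tendsto_one_sub_cos_div {u φ : ℕ → ℝ} {τ : ℝ} (hu : Tendsto u atTop (𝓝[>] 0))
    (hφ : Tendsto (fun n => φ n / √(u n)) atTop (𝓝 τ)) :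
    Tendsto φ atTop (𝓝 0) ∧
      Tendsto (fun n => (1 - Real.cos (φ n)) / u n) atTop (𝓝 (τ ^ 2 / 2)) := by
  have hupos : ∀ᶠ n in atTop, 0 < u n := hu.eventually self_mem_nhdsWithin
  have hs : Tendsto (fun n => √(u n)) atTop (𝓝 0) := by
    have := (Real.continuous_sqrt.tendsto 0).comp (hu.mono_right nhdsWithin_le_nhds)
    simpa [Function.comp_def] using this
  have h0 : Tendsto φ atTop (𝓝 0) := by
    have := hφ.mul hs
    rw [mul_zero] at this
    refine this.congr' ?_
    filter_upwards [hupos] with n hn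
    exact div_mul_cancel₀ _ (Real.sqrt_pos.2 hn).ne'
  refine ⟨h0, ?_⟩
  have h1 : Tendsto (fun n => Real.sinc (φ n / 2)) atTop (𝓝 1) := by
    have := (Real.continuous_sinc.tendsto (0 / 2)).comp (h0.div_const 2)
    simpa [Function.comp_def] using this
  have := ((hφ.pow 2).div_const 2).mul (h1.pow 2)
  rw [one_pow, mul_one] at this
  refine this.congr' ?_
  filter_upwards [hupos] with n hn
  rw [one_sub_cos_eq, div_pow, Real.sq_sqrt hn.le]
  ring

/-- If `ρ_n` approaches `1` at rate `2 λ² u_n`, the angle `arccos ρ_n` is of order `2 λ √u_n`. -/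
theorem tendsto_arccos_div_sqrt {u ρ : ℕ → ℝ} {lam : ℝ} (hlam : 0 ≤ lam)
    (hu : Tendsto u atTop (𝓝[>] 0)) (hρ : ∀ᶠ n in atTop, 0 < ρ n ∧ ρ n ≤ 1)
    (hlim : Tendsto (fun n => (1 - ρ n) / u n) atTop (𝓝 (2 * lam ^ 2))) :
    Tendsto (fun n => Real.arccos (ρ n) / √(u n)) atTop (𝓝 (2 * lam)) := by
  have hupos : ∀ᶠ n in atTop, 0 < u n := hu.eventually self_mem_nhdsWithin
  have hu0 := hu.mono_right nhdsWithin_le_nhds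
  have hρ1 : Tendsto ρ atTop (𝓝 1) := by
    have := tendsto_const_nhds (x := (1 : ℝ)).sub (hlim.mul hu0)
    rw [mul_zero, sub_zero] at this
    refine this.congr' ?_
    filter_upwards [hupos] with n hn
    rw [div_mul_cancel₀ _ hn.ne']
    ring
  have hψ : Tendsto (fun n => Real.arccos (ρ n)) atTop (𝓝 0) := by
    have := (Real.continuous_arccos.tendsto 1).comp hρ1
    simpa [Function.comp_def] using this
  have h1 : Tendsto (fun n => Real.sinc (Real.arccos (ρ n) / 2)) atTop (𝓝 1) := by
    have := (Real.continuous_sinc.tendsto (0 / 2)).comp (hψ.div_const 2)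
    simpa [Function.comp_def] using this
  have h2 := ((Real.continuous_sqrt.tendsto _).comp (hlim.mul_const 2)).div h1 one_ne_zero
  rw [show 2 * lam ^ 2 * 2 = (2 * lam) ^ 2 by ring, Real.sqrt_sq (by positivity), div_one] at h2
  refine h2.congr' ?_
  filter_upwards [hupos, hρ, h1.eventually_const_lt zero_lt_one] with n hn hr hs
  have e := one_sub_cos_eq (Real.arccos (ρ n))
  rw [Real.cos_arccos (by linarith [hr.1]) hr.2] at e
  have : (1 - ρ n) / u n * 2 =
      (Real.arccos (ρ n) / √(u n) * Real.sinc (Real.arccos (ρ n) / 2)) ^ 2 := by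
    rw [e, mul_pow, div_pow, Real.sq_sqrt hn.le]
    ring
  simp only [Pi.div_apply, Function.comp]
  rw [this, Real.sqrt_sq (mul_nonneg (div_nonneg (Real.arccos_nonneg _) (Real.sqrt_nonneg _)) hs.le),
    mul_div_cancel_right₀ _ hs.ne']

/-! ### Tails in a fixed direction and their angular integrals. -/

/-- The probability that a point of random modulus with law `μ` and argument `φ` has abscissa
greater than `a`. -/
noncomputable def cosTail (μ : Measure ℝ) (a φ : ℝ) : ℝ := μ.real {r | a < r * Real.cos φ}

/-- The limit profile of the tail `cosTail`. -/
noncomputable def parabola (α v t : ℝ) : ℝ := max (v - t ^ 2 / 2) 0 ^ α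

theorem cosTail_nonneg (μ : Measure ℝ) (a φ : ℝ) : 0 ≤ cosTail μ a φ := measureReal_nonneg

theorem measurable_cosTail (μ : Measure ℝ) [IsProbabilityMeasure μ] (a : ℝ) :
    Measurable (cosTail μ a) := by
  have hs : MeasurableSet {p : ℝ × ℝ | a < p.2 * Real.cos p.1} :=
    measurableSet_lt measurable_const (by fun_prop)
  exact (measurable_measure_prodMk_left hs (ν := μ)).ennreal_toReal

/-- For `cos φ > 0` the event is `r > 1 - u c` with `c = (v - (1 - cos φ) / u) / cos φ`, and `c → v
- τ² / 2`. -/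
theorem tendsto_cosTail_div {μ : Measure ℝ} [IsProbabilityMeasure μ] {α : ℝ} (hα : 0 < α)
    (hμ : WeibullLaw μ α) {u φ : ℕ → ℝ} {v τ : ℝ} (hu : Tendsto u atTop (𝓝[>] 0))
    (hφ : Tendsto (fun n => φ n / √(u n)) atTop (𝓝 τ)) :
    Tendsto (fun n => cosTail μ (1 - u n * v) (φ n) / μ.real (Set.Ioi (1 - u n)))
      atTop (𝓝 (parabola α v τ)) := by
  have hupos : ∀ᶠ n in atTop, 0 < u n := hu.eventually self_mem_nhdsWithin
  obtain ⟨h0, h1⟩ := tendsto_one_sub_cos_div hu hφ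
  have hcos : Tendsto (fun n => Real.cos (φ n)) atTop (𝓝 1) := by
    simpa [Function.comp_def] using (Real.continuous_cos.tendsto 0).comp h0
  have hc : Tendsto (fun n => (v - (1 - Real.cos (φ n)) / u n) / Real.cos (φ n)) atTop
      (𝓝 (v - τ ^ 2 / 2)) := by
    simpa [Pi.div_def] using (h1.const_sub v).div hcos one_ne_zero
  refine (tendsto_max_rpow_div hα hμ hu hc).congr' ?_
  filter_upwards [hupos, hcos.eventually_const_lt zero_lt_one] with n hn hp
  congr 2
  ext r
  rw [Set.mem_Ioi, Set.mem_ofPred_eq, ← div_lt_iff₀ hp]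
  have : 1 - u n * ((v - (1 - Real.cos (φ n)) / u n) / Real.cos (φ n)) =
      (1 - u n * v) / Real.cos (φ n) := by
    field_simp
    ring
  rw [this]

theorem cosTail_le {μ : Measure ℝ} [IsProbabilityMeasure μ] {α : ℝ}
    (hμ : WeibullLaw μ α) (a φ : ℝ) : cosTail μ a φ ≤ μ.real (Set.Ioi a) := by
  refine ENNReal.toReal_mono (measure_ne_top _ _) (measure_mono_ae ?_)
  filter_upwards [hμ.pos] with r hr h
  exact lt_of_lt_of_le (show a < r * Real.cos φ from h)
    (mul_le_of_le_one_right hr.le (Real.cos_le_one φ))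

theorem cosTail_eq_zero {μ : Measure ℝ} [IsProbabilityMeasure μ] {α : ℝ}
    (hμ : WeibullLaw μ α) {a φ : ℝ} (ha : 0 ≤ a) (h : Real.cos φ ≤ a) : cosTail μ a φ = 0 := by
  rw [cosTail, measureReal_eq_zero_iff, ← nonpos_iff_eq_zero, ← measure_empty (μ := μ)]
  refine measure_mono_ae ?_
  filter_upwards [hμ.pos, hμ.le_one] with r hr hr1 hlt
  exact absurd (show a < r * Real.cos φ from hlt) (not_lt.2 (by nlinarith))

/-- Domination for the rescaled integrand. A nonzero tail forces `cos φ > 1 - u v`, and the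
quadratic upper bound for cosine on `[-π, π]` then gives `φ² = O(u)`, so `t` stays in a fixed
window. The bounds by `π / 2` keep `φ` in that range. -/
theorem exists_cosTail_bound {μ : Measure ℝ} [IsProbabilityMeasure μ] {α : ℝ}
    (hμ : WeibullLaw μ α) {u ψ : ℕ → ℝ} {v τ : ℝ} (hv : 0 < v)
    (hu : Tendsto u atTop (𝓝[>] 0))
    (hψ' : ∀ᶠ n in atTop, |ψ n| ≤ Real.pi / 2)
    (hψ : Tendsto (fun n => ψ n / √(u n)) atTop (𝓝 τ)) :
    ∃ T C : ℝ, 0 ≤ C ∧ ∀ᶠ n in atTop, ∀ t : ℝ,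
      √(u n) * t ∈ Set.Ioc (-(Real.pi / 2)) (Real.pi / 2) →
      cosTail μ (1 - u n * v) (√(u n) * t - ψ n) / μ.real (Set.Ioi (1 - u n)) ≤
        (Set.Icc (-T) T).indicator (fun _ => C) t := by
  have hupos : ∀ᶠ n in atTop, 0 < u n := hu.eventually self_mem_nhdsWithin
  have hu0 := hu.mono_right nhdsWithin_le_nhds
  have huv : Tendsto (fun n => u n * v) atTop (𝓝 0) := by simpa using hu0.mul_const v
  -- `|τ| + 1` eventually bounds `|ψ n| / √(u n)`, the root bounds the distance from `t` to that
  -- centre, and `v ^ α + 1` eventually bounds the tail ratio.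
  refine ⟨|τ| + 1 + √(Real.pi ^ 2 / 2 * v), v ^ α + 1, by positivity, ?_⟩
  filter_upwards [hupos, hψ', hψ.abs.eventually_lt_const (lt_add_one |τ|),
    ((hμ.tail v hv).comp hu).eventually_lt_const (lt_add_one _),
    huv.eventually_lt_const zero_lt_one] with n hn hpsi hT hC h1 t ht
  set φ := √(u n) * t - ψ n with hφdef
  rcases le_or_gt (Real.cos φ) (1 - u n * v) with hcos | hcos
  · rw [cosTail_eq_zero hμ (by linarith) hcos, zero_div]
    exact Set.indicator_nonneg (fun _ _ => by positivity) _
  have hs : 0 < √(u n) := Real.sqrt_pos.2 hn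
  rw [Set.indicator_of_mem]
  · refine le_trans ?_ hC.le
    dsimp only [Function.comp]
    gcongr
    exact cosTail_le hμ _ _
  · have hφπ : |φ| ≤ Real.pi := by
      have h2 : |√(u n) * t| ≤ Real.pi / 2 := abs_le.2 ⟨ht.1.le, ht.2⟩
      have := abs_sub (√(u n) * t) (ψ n)
      linarith
    have hq := Real.cos_le_one_sub_mul_cos_sq hφπ
    have hφeq : φ = √(u n) * (t - ψ n / √(u n)) := by
      rw [hφdef, mul_sub, mul_div_cancel₀ _ hs.ne']
    have hφsq : φ ^ 2 = u n * (t - ψ n / √(u n)) ^ 2 := by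
      rw [hφeq, mul_pow, Real.sq_sqrt hn.le]
    have hpi := Real.pi_pos
    have h3 : 2 / Real.pi ^ 2 * (t - ψ n / √(u n)) ^ 2 < v := by
      rw [hφsq] at hq
      have : u n * (2 / Real.pi ^ 2 * (t - ψ n / √(u n)) ^ 2) < u n * v := by
        have : 2 / Real.pi ^ 2 * (u n * (t - ψ n / √(u n)) ^ 2) =
          u n * (2 / Real.pi ^ 2 * (t - ψ n / √(u n)) ^ 2) := by ring
        linarith
      exact lt_of_mul_lt_mul_left this hn.le
    have h4 : (t - ψ n / √(u n)) ^ 2 ≤ Real.pi ^ 2 / 2 * v := by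
      calc (t - ψ n / √(u n)) ^ 2
          = Real.pi ^ 2 / 2 * (2 / Real.pi ^ 2 * (t - ψ n / √(u n)) ^ 2) := by
            field_simp
        _ ≤ _ := by gcongr
    have h5 := Real.abs_le_sqrt h4
    have h6 : |t| ≤ |t - ψ n / √(u n)| + |ψ n / √(u n)| := by
      simpa using abs_add_le (t - ψ n / √(u n)) (ψ n / √(u n))
    exact abs_le.1 (by linarith)

theorem tendsto_integral_max_cosTail {μ : Measure ℝ} [IsProbabilityMeasure μ] {α : ℝ}
    (hα : 0 < α) (hμ : WeibullLaw μ α) {u ψ₁ ψ₂ : ℕ → ℝ} {v w τ₁ τ₂ : ℝ}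
    (hv : 0 < v) (hw : 0 < w) (hu : Tendsto u atTop (𝓝[>] 0))
    (hψ₁' : ∀ᶠ n in atTop, |ψ₁ n| ≤ Real.pi / 2)
    (hψ₁ : Tendsto (fun n => ψ₁ n / √(u n)) atTop (𝓝 τ₁))
    (hψ₂' : ∀ᶠ n in atTop, |ψ₂ n| ≤ Real.pi / 2)
    (hψ₂ : Tendsto (fun n => ψ₂ n / √(u n)) atTop (𝓝 τ₂)) :
    Tendsto (fun n => (∫ θ in -(Real.pi / 2)..Real.pi / 2,
        max (cosTail μ (1 - u n * v) (θ - ψ₁ n)) (cosTail μ (1 - u n * w) (θ - ψ₂ n))) /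
          (√(u n) * μ.real (Set.Ioi (1 - u n))))
      atTop (𝓝 (∫ t, max (parabola α v (t - τ₁)) (parabola α w (t - τ₂)))) := by
  have hupos : ∀ᶠ n in atTop, 0 < u n := hu.eventually self_mem_nhdsWithin
  have hu0 := hu.mono_right nhdsWithin_le_nhds
  have hs0 : Tendsto (fun n => √(u n)) atTop (𝓝 0) := by
    simpa [Function.comp_def] using (Real.continuous_sqrt.tendsto 0).comp hu0
  obtain ⟨T₁, C₁, hC₁, hb₁⟩ := exists_cosTail_bound hμ hv hu hψ₁' hψ₁
  obtain ⟨T₂, C₂, hC₂, hb₂⟩ := exists_cosTail_bound hμ hw hu hψ₂' hψ₂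
  -- Extension by zero lets `θ = √(u n) * t` be substituted on the whole line; each fixed `t`
  -- eventually lies in the rescaled interval.
  set I := Set.Ioc (-(Real.pi / 2)) (Real.pi / 2)
  let f : ℕ → ℝ → ℝ := fun n θ =>
    max (cosTail μ (1 - u n * v) (θ - ψ₁ n)) (cosTail μ (1 - u n * w) (θ - ψ₂ n))
  have hf : ∀ n, Measurable (f n) := fun n =>
    ((measurable_cosTail μ _).comp (measurable_id.sub_const _)).max
      ((measurable_cosTail μ _).comp (measurable_id.sub_const _))
  have hf0 : ∀ n θ, 0 ≤ f n θ := fun n θ => (cosTail_nonneg _ _ _).trans (le_max_left _ _)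
  have key : Tendsto (fun n => ∫ t, I.indicator (f n) (√(u n) * t) / μ.real (Set.Ioi (1 - u n)))
      atTop (𝓝 (∫ t, max (parabola α v (t - τ₁)) (parabola α w (t - τ₂)))) := by
    refine tendsto_integral_filter_of_dominated_convergence
      (fun t => (Set.Icc (-T₁) T₁).indicator (fun _ => C₁) t +
        (Set.Icc (-T₂) T₂).indicator (fun _ => C₂) t) ?_ ?_ ?_ ?_
    · refine Eventually.of_forall fun n => Measurable.aestronglyMeasurable ?_
      exact (((hf n).indicator measurableSet_Ioc).comp (measurable_const_mul _)).div_const _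
    · filter_upwards [hb₁, hb₂, hupos] with n h₁ h₂ hn
      refine Eventually.of_forall fun t => ?_
      have i₁ : 0 ≤ (Set.Icc (-T₁) T₁).indicator (fun _ => C₁) t :=
        Set.indicator_nonneg (fun _ _ => hC₁) _
      have i₂ : 0 ≤ (Set.Icc (-T₂) T₂).indicator (fun _ => C₂) t :=
        Set.indicator_nonneg (fun _ _ => hC₂) _
      rw [Real.norm_of_nonneg (div_nonneg (Set.indicator_nonneg (fun _ _ => hf0 _ _) _)
        measureReal_nonneg)]
      by_cases ht : √(u n) * t ∈ I
      · rw [Set.indicator_of_mem ht, ← max_div_div_right measureReal_nonneg]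
        exact max_le ((h₁ t ht).trans (le_add_of_nonneg_right i₂))
          ((h₂ t ht).trans (le_add_of_nonneg_left i₁))
      · rw [Set.indicator_of_notMem ht, zero_div]
        exact add_nonneg i₁ i₂
    · refine Integrable.add ?_ ?_ <;>
        exact (integrable_indicator_iff measurableSet_Icc).2
          (integrableOn_const (by simp))
    · refine Eventually.of_forall fun t => ?_
      have hst : Tendsto (fun n => √(u n) * t) atTop (𝓝 0) := by simpa using hs0.mul_const t
      have lim : ∀ {ψ : ℕ → ℝ} {τ : ℝ}, Tendsto (fun n => ψ n / √(u n)) atTop (𝓝 τ) →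
          Tendsto (fun n => (√(u n) * t - ψ n) / √(u n)) atTop (𝓝 (t - τ)) := by
        intro ψ τ h
        refine (h.const_sub t).congr' ?_
        filter_upwards [hupos] with n hn
        rw [sub_div, mul_div_cancel_left₀ _ (Real.sqrt_pos.2 hn).ne']
      refine ((tendsto_cosTail_div hα hμ (v := v) hu (lim hψ₁)).max
        (tendsto_cosTail_div hα hμ (v := w) hu (lim hψ₂))).congr' ?_
      have hpi := Real.pi_pos
      filter_upwards [hst.eventually_const_lt (show -(Real.pi / 2) < 0 by linarith),
        hst.eventually_lt_const (show 0 < Real.pi / 2 by linarith)] with n h₁ h₂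
      have hI : √(u n) * t ∈ I := ⟨h₁, h₂.le⟩
      rw [Set.indicator_of_mem hI, ← max_div_div_right measureReal_nonneg]
  refine key.congr' ?_
  filter_upwards [hupos] with n hn
  have hs : 0 < √(u n) := Real.sqrt_pos.2 hn
  rw [integral_div, Measure.integral_comp_mul_left (I.indicator (f n)) (√(u n)),
    integral_indicator measurableSet_Ioc, abs_of_pos (inv_pos.2 hs), smul_eq_mul,
    intervalIntegral.integral_of_le (by linarith [Real.pi_pos])]
  field_simp
  rfl

/-! ### Polar formulas for the exceedance probabilities. -/

/-- The law of a polar pair, folded to angles in `[-π/2, π/2]`. -/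
theorem HalfSkew.IsPolarPair.measureReal_eq {Ω Ω' : Type*} [MeasurableSpace Ω] [MeasurableSpace Ω']
    {P : Measure Ω} {P' : Measure Ω'} [IsProbabilityMeasure P']
    {X Y : Ω → ℝ} {R Θ : Ω' → ℝ} (h : HalfSkew.IsPolarPair X Y P R Θ P')
    {E : Set (ℝ × ℝ)} (hE : MeasurableSet E) :
    P.real {ω | (X ω, Y ω) ∈ E} = (2 * Real.pi)⁻¹ *
      ((∫ θ in -(Real.pi / 2)..Real.pi / 2,
          (P'.map R).real {r | (r * Real.cos θ, r * Real.sin θ) ∈ E}) +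
        ∫ θ in -(Real.pi / 2)..Real.pi / 2,
          (P'.map R).real {r | (r * -Real.cos θ, r * Real.sin θ) ∈ E}) := by
  have hpi := Real.pi_pos
  have hμ : IsProbabilityMeasure (P'.map R) :=
    Measure.isProbabilityMeasure_map h.aemeasurable_radius
  have hvol : volume (Set.Ioo (-Real.pi) Real.pi) = ENNReal.ofReal (2 * Real.pi) := by
    rw [Real.volume_Ioo]; congr 1; ring
  have hΘ : AEMeasurable Θ P' := h.angle_uniform.aemeasurable
    (by rw [hvol]; simpa using hpi) (by rw [hvol]; exact ENNReal.ofReal_ne_top)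
  have hmeas : Measurable fun p : ℝ × ℝ => (p.1 * Real.cos p.2, p.1 * Real.sin p.2) := by
    fun_prop
  let q : ℝ → ℝ := fun θ => (P'.map R).real {r | (r * Real.cos θ, r * Real.sin θ) ∈ E}
  have hqm : Measurable q :=
    (measurable_measure_prodMk_right (μ := P'.map R) (hmeas hE)).ennreal_toReal
  have hqi : ∀ a b : ℝ, IntervalIntegrable q volume a b := fun a b => by
    refine (intervalIntegrable_const (c := (1 : ℝ))).mono_fun hqm.aestronglyMeasurable ?_
    refine Eventually.of_forall fun θ => ?_
    simp only [q, norm_one, Real.norm_of_nonneg measureReal_nonneg]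
    exact measureReal_le_one
  have hper : Function.Periodic q (2 * Real.pi) := fun θ => by
    simp only [q, Real.cos_add_two_pi, Real.sin_add_two_pi]
  have law : P.real {ω | (X ω, Y ω) ∈ E} = (2 * Real.pi)⁻¹ * ∫ θ in -Real.pi..Real.pi, q θ := by
    have h1 : P {ω | (X ω, Y ω) ∈ E} =
        P' ((fun ω => (R ω, Θ ω)) ⁻¹' ((fun p : ℝ × ℝ =>
          (p.1 * Real.cos p.2, p.1 * Real.sin p.2)) ⁻¹' E)) :=
      h.identDistrib.measure_mem_eq hE
    rw [measureReal_def, h1, ← Measure.map_apply_of_aemeasurable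
      (h.aemeasurable_radius.prodMk hΘ) (hmeas hE),
      (indepFun_iff_map_prod_eq_prod_map_map h.aemeasurable_radius hΘ).1 h.indep,
      show P'.map Θ = _ from h.angle_uniform, Measure.prod_apply_symm (hmeas hE),
      ProbabilityTheory.cond, lintegral_smul_measure, hvol, smul_eq_mul, ENNReal.toReal_mul,
      ENNReal.toReal_inv, ENNReal.toReal_ofReal (by positivity),
      intervalIntegral.integral_of_le (by linarith), integral_Ioc_eq_integral_Ioo,
      integral_eq_lintegral_of_nonneg_ae (Eventually.of_forall fun _ => measureReal_nonneg)
        hqm.aestronglyMeasurable]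
    congr 2
    refine lintegral_congr fun θ => ?_
    exact (ofReal_measureReal).symm
  rw [law]
  congr 1
  -- Periodicity moves the range to `[-π/2, 3π/2]`; its second half is folded back by `θ ↦ π - θ`.
  have e1 := hper.intervalIntegral_add_eq (-Real.pi) (-(Real.pi / 2))
  rw [show -Real.pi + 2 * Real.pi = Real.pi by ring,
    show -(Real.pi / 2) + 2 * Real.pi = Real.pi - -(Real.pi / 2) by ring] at e1
  have e2 := intervalIntegral.integral_comp_sub_left (a := -(Real.pi / 2)) (b := Real.pi / 2)
    q Real.pi
  rw [show Real.pi - Real.pi / 2 = Real.pi / 2 by ring] at e2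
  rw [e1, ← intervalIntegral.integral_add_adjacent_intervals (hqi _ (Real.pi / 2)) (hqi _ _), ← e2]
  simp only [q, Real.cos_pi_sub, Real.sin_pi_sub]

theorem cos_sub_arccos {ρ : ℝ} (h0 : 0 < ρ) (h1 : ρ ≤ 1) (θ : ℝ) :
    ρ * Real.cos θ + √(1 - ρ ^ 2) * Real.sin θ = Real.cos (θ - Real.arccos ρ) := by
  rw [Real.cos_sub, Real.cos_arccos (by linarith) h1, Real.sin_arccos]
  ring

theorem measurable_skew (ρ : ℝ) :
    Measurable fun p : ℝ × ℝ => HalfSkew.skew ρ p.1 p.2 := by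
  unfold HalfSkew.skew
  fun_prop

theorem skew_polar {ρ : ℝ} (h0 : 0 < ρ) (h1 : ρ ≤ 1) {r θ : ℝ} (hr : 0 < r)
    (hθ : 0 ≤ Real.cos θ) :
    HalfSkew.skew ρ (r * Real.cos θ) (r * Real.sin θ) = r * Real.cos (θ - Real.arccos ρ) ∧
    HalfSkew.skew ρ (r * -Real.cos θ) (r * Real.sin θ) = r * Real.cos (θ - Real.arccos ρ) := by
  rw [← cos_sub_arccos h0 h1]
  constructor <;>
  · rw [HalfSkew.skew, abs_mul, abs_of_pos hr]
    simp only [abs_neg, abs_of_nonneg hθ]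
    ring

/-- Replaces inclusion-exclusion by a pointwise maximum. Nonnegative levels matter: an exceedance at
positive radius then forces a positive cosine. -/
theorem measureReal_union_cosTail {μ : Measure ℝ} [IsProbabilityMeasure μ] {α : ℝ}
    (hμ : WeibullLaw μ α) {a b : ℝ} (ha : 0 ≤ a) (hb : 0 ≤ b) (φ χ : ℝ) :
    μ.real {r | a < r * Real.cos φ ∨ b < r * Real.cos χ} =
      max (cosTail μ a φ) (cosTail μ b χ) := by
  -- for `r > 0` each of the two sets is an upper set, so that they are nested
  have nested : ({r | 0 < r ∧ a < r * Real.cos φ} : Set ℝ) ⊆ {r | 0 < r ∧ b < r * Real.cos χ} ∨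
      ({r | 0 < r ∧ b < r * Real.cos χ} : Set ℝ) ⊆ {r | 0 < r ∧ a < r * Real.cos φ} := by
    have upper : ∀ (c ξ : ℝ), 0 ≤ c → ∀ {r s : ℝ}, 0 < r → r ≤ s → c < r * Real.cos ξ →
        c < s * Real.cos ξ := fun c ξ hc r s hr hrs h => by
      have : 0 < Real.cos ξ := pos_of_mul_pos_right (hc.trans_lt h) hr.le
      exact h.trans_le (mul_le_mul_of_nonneg_right hrs this.le)
    by_contra! hcon
    obtain ⟨⟨r, ⟨hr, hra⟩, hrb⟩, s, ⟨hs, hsb⟩, hsa⟩ :=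
      hcon.imp Set.not_subset.1 Set.not_subset.1
    rcases le_total r s with hrs | hrs
    · exact hsa ⟨hs, upper a φ ha hr hrs hra⟩
    · exact hrb ⟨hr, upper b χ hb hs hrs hsb⟩
  have mono : ∀ {s t : Set ℝ}, (∀ r, 0 < r → r ∈ s → r ∈ t) → μ.real s ≤ μ.real t :=
    fun {s t} h => ENNReal.toReal_mono (measure_ne_top _ _) (measure_mono_ae (by
      filter_upwards [hμ.pos] with r hr hrs using h r hr hrs))
  refine le_antisymm ?_ (max_le (mono fun r _ h => Or.inl h) (mono fun r _ h => Or.inr h))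
  rcases nested with h | h
  · exact (mono fun r hr hor => hor.elim (fun h' => (h ⟨hr, h'⟩).2) id).trans (le_max_right _ _)
  · exact (mono fun r hr hor => hor.elim id fun h' => (h ⟨hr, h'⟩).2).trans (le_max_left _ _)

theorem measureReal_congr_pos {μ : Measure ℝ} {α : ℝ} (hμ : WeibullLaw μ α) {s t : Set ℝ}
    (h : ∀ r, 0 < r → (r ∈ s ↔ r ∈ t)) : μ.real s = μ.real t :=
  measureReal_congr (by filter_upwards [hμ.pos] with r hr using propext (h r hr))

section Pair

variable {Ω Ω' : Type*} [MeasurableSpace Ω] [MeasurableSpace Ω']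
  {P : Measure Ω} {P' : Measure Ω'} [IsProbabilityMeasure P']
  {X Y : Ω → ℝ} {R Θ : Ω' → ℝ} {α ρ a b : ℝ}

theorem HalfSkew.IsPolarPair.measureReal_skew_gt (h : HalfSkew.IsPolarPair X Y P R Θ P')
    (hμ : WeibullLaw (P'.map R) α) (h0 : 0 < ρ) (h1 : ρ ≤ 1) :
    P.real {ω | b < HalfSkew.skew ρ (X ω) (Y ω)} = (2 * Real.pi)⁻¹ * (2 *
      ∫ θ in -(Real.pi / 2)..Real.pi / 2, cosTail (P'.map R) b (θ - Real.arccos ρ)) := by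
  have hE : MeasurableSet {p : ℝ × ℝ | b < HalfSkew.skew ρ p.1 p.2} :=
    measurableSet_lt measurable_const (measurable_skew ρ)
  refine (HalfSkew.IsPolarPair.measureReal_eq h hE).trans ?_
  rw [two_mul (intervalIntegral _ _ _ _)]
  congr 2 <;>
  · refine intervalIntegral.integral_congr fun θ hθ => ?_
    rw [Set.uIcc_of_le (by linarith [Real.pi_pos])] at hθ
    have hc := Real.cos_nonneg_of_mem_Icc hθ
    refine measureReal_congr_pos hμ fun r hr => ?_
    simp only [Set.mem_ofPred_eq, skew_polar h0 h1 hr hc]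

/-- The second integral is the left half-plane, where `X ≤ 0 ≤ a` leaves only the skew exceedance;
it is the source of the `1` in `1 + Υ`. Writing `θ - 0` matches the general form with two shifts. -/
theorem HalfSkew.IsPolarPair.measureReal_gt_or_skew_gt
    (h : HalfSkew.IsPolarPair X Y P R Θ P')
    (hμ : WeibullLaw (P'.map R) α) (h0 : 0 < ρ) (h1 : ρ ≤ 1) (ha : 0 ≤ a) (hb : 0 ≤ b) :
    P.real {ω | a < X ω ∨ b < HalfSkew.skew ρ (X ω) (Y ω)} = (2 * Real.pi)⁻¹ *
      ((∫ θ in -(Real.pi / 2)..Real.pi / 2,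
          max (cosTail (P'.map R) a (θ - 0)) (cosTail (P'.map R) b (θ - Real.arccos ρ))) +
        ∫ θ in -(Real.pi / 2)..Real.pi / 2, cosTail (P'.map R) b (θ - Real.arccos ρ)) := by
  have : IsProbabilityMeasure (P'.map R) :=
    Measure.isProbabilityMeasure_map h.aemeasurable_radius
  have hE : MeasurableSet {p : ℝ × ℝ | a < p.1 ∨ b < HalfSkew.skew ρ p.1 p.2} :=
    (measurableSet_lt measurable_const measurable_fst).union
      (measurableSet_lt measurable_const (measurable_skew ρ))
  refine (HalfSkew.IsPolarPair.measureReal_eq h hE).trans ?_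
  congr 2
  · refine intervalIntegral.integral_congr fun θ hθ => ?_
    rw [Set.uIcc_of_le (by linarith [Real.pi_pos])] at hθ
    have hc := Real.cos_nonneg_of_mem_Icc hθ
    rw [sub_zero, ← measureReal_union_cosTail hμ ha hb]
    refine measureReal_congr_pos hμ fun r hr => ?_
    simp only [Set.mem_ofPred_eq, skew_polar h0 h1 hr hc]
  · refine intervalIntegral.integral_congr fun θ hθ => ?_
    rw [Set.uIcc_of_le (by linarith [Real.pi_pos])] at hθ
    have hc := Real.cos_nonneg_of_mem_Icc hθ
    refine measureReal_congr_pos hμ fun r hr => ?_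
    simp only [Set.mem_ofPred_eq, skew_polar h0 h1 hr hc]
    have : ¬ a < r * -Real.cos θ := by nlinarith
    exact or_iff_right this

end Pair

/-! ### Evaluation of the limiting integrals. -/

theorem continuous_one_sub_sq_rpow {α : ℝ} (hα : 0 < α) :
    Continuous fun s : ℝ => (1 - s ^ 2) ^ α :=
  (by fun_prop : Continuous fun s : ℝ => 1 - s ^ 2).rpow_const fun _ => Or.inr hα.le

theorem integral_one_sub_sq_rpow_pos {α : ℝ} (hα : 0 < α) :
    0 < ∫ s in (-1 : ℝ)..1, (1 - s ^ 2) ^ α :=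
  intervalIntegral.intervalIntegral_pos_of_pos_on
    ((continuous_one_sub_sq_rpow hα).intervalIntegrable _ _)
    (fun s hs => Real.rpow_pos_of_pos (by nlinarith [hs.1, hs.2]) _) (by norm_num)

theorem sqrt_two_mul_integral_eq {α : ℝ} (hα : 0 < α) :
    √2 * ∫ s in (-1 : ℝ)..1, (1 - s ^ 2) ^ α = 2 * Real.pi * HalfSkew.constI α := by
  have hint := fun a b => (continuous_one_sub_sq_rpow hα).intervalIntegrable (μ := volume) a b
  have hneg : ∫ s in (-1 : ℝ)..0, (1 - s ^ 2) ^ α = ∫ s in (0 : ℝ)..1, (1 - s ^ 2) ^ α := by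
    have := intervalIntegral.integral_comp_neg (a := 0) (b := 1) fun s : ℝ => (1 - s ^ 2) ^ α
    simpa using this.symm
  rw [← intervalIntegral.integral_add_adjacent_intervals (hint (-1) 0) (hint 0 1), hneg,
    HalfSkew.constI]
  field_simp
  ring

theorem setIntegral_Iic_bump {α : ℝ} (hα : 0 < α) (τ : ℝ) :
    ∫ s in Set.Iic τ, max (1 - s ^ 2) 0 ^ α =
      (∫ s in (-1 : ℝ)..1, (1 - s ^ 2) ^ α) * HalfSkew.upsilon α τ := by
  have hbump : ∀ s : ℝ, max (1 - s ^ 2) 0 ^ α =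
      (Set.Ioc (-1 : ℝ) 1).indicator (fun s => (1 - s ^ 2) ^ α) s := fun s => by
    by_cases hs : s ∈ Set.Ioc (-1 : ℝ) 1
    · rw [Set.indicator_of_mem hs, max_eq_left (by nlinarith [hs.1, hs.2])]
    · rw [Set.indicator_of_notMem hs, max_eq_right, Real.zero_rpow hα.ne']
      rw [Set.mem_Ioc, not_and_or, not_lt, not_le] at hs
      rcases hs with hs | hs <;> nlinarith
  simp_rw [hbump]
  rw [setIntegral_indicator measurableSet_Ioc, HalfSkew.upsilon,
    mul_div_cancel₀ _ (integral_one_sub_sq_rpow_pos hα).ne',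
    intervalIntegral.integral_of_le (le_max_left _ _)]
  congr 2
  ext s
  simp only [Set.mem_inter_iff, Set.mem_Iic, Set.mem_Ioc, le_max_iff, le_min_iff]
  constructor
  · tauto
  · rintro ⟨h1, h2 | h2⟩
    · exact absurd h1 (not_lt.2 h2)
    · tauto

theorem integral_bump {α : ℝ} (hα : 0 < α) :
    ∫ s : ℝ, max (1 - s ^ 2) 0 ^ α = ∫ s in (-1 : ℝ)..1, (1 - s ^ 2) ^ α := by
  have h1 : HalfSkew.upsilon α 1 = 1 := by
    have := (integral_one_sub_sq_rpow_pos hα).ne'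
    simp [HalfSkew.upsilon, this]
  have h2 := setIntegral_Iic_bump hα 1
  rw [h1, mul_one] at h2
  rw [← h2, setIntegral_eq_integral_of_forall_compl_eq_zero]
  intro s hs
  rw [Set.mem_Iic, not_le] at hs
  rw [max_eq_right (by nlinarith), Real.zero_rpow hα.ne']

theorem parabola_eq {α v : ℝ} (hv : 0 < v) (t : ℝ) :
    parabola α v t = v ^ α * max (1 - ((√(2 * v))⁻¹ * t) ^ 2) 0 ^ α := by
  rw [parabola, ← Real.mul_rpow hv.le (le_max_right _ _), mul_max_of_nonneg _ _ hv.le, mul_zero,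
    mul_pow, inv_pow, Real.sq_sqrt (by positivity)]
  congr 2
  field_simp

/-- The substitution `s = t / √(2v)` reduces to the standard bump; its Jacobian times `v ^ α`
supplies the exponent `1/2 + α` and the `√2` in `constI`. -/
theorem setIntegral_Iic_parabola {α v : ℝ} (hα : 0 < α) (hv : 0 < v) (τ : ℝ) :
    (2 * Real.pi)⁻¹ * ∫ t in Set.Iic τ, parabola α v t =
      HalfSkew.constI α * (v ^ (1 / 2 + α) * HalfSkew.upsilon α (τ / √(2 * v))) := by
  have hs : 0 < √(2 * v) := by positivity
  have hsub : ∫ t in Set.Iic τ, max (1 - ((√(2 * v))⁻¹ * t) ^ 2) 0 ^ α =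
      √(2 * v) * ∫ s in Set.Iic (τ / √(2 * v)), max (1 - s ^ 2) 0 ^ α := by
    rw [← integral_indicator measurableSet_Iic, ← integral_indicator measurableSet_Iic]
    have := Measure.integral_comp_mul_left ((Set.Iic (τ / √(2 * v))).indicator
      fun s : ℝ => max (1 - s ^ 2) 0 ^ α) (√(2 * v))⁻¹
    rw [inv_inv, abs_of_pos hs, smul_eq_mul] at this
    rw [← this]
    congr 1
    ext t
    have hmem : t ∈ Set.Iic τ ↔ (√(2 * v))⁻¹ * t ∈ Set.Iic (τ / √(2 * v)) := by
      rw [Set.mem_Iic, Set.mem_Iic, inv_mul_eq_div, div_le_div_iff_of_pos_right hs]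
    simp only [Set.indicator_apply, hmem]
  simp_rw [parabola_eq hv]
  rw [integral_const_mul, hsub, setIntegral_Iic_bump hα, Real.sqrt_mul zero_le_two,
    Real.rpow_add hv, ← Real.sqrt_eq_rpow]
  have e := sqrt_two_mul_integral_eq hα
  set B := ∫ s in (-1 : ℝ)..1, (1 - s ^ 2) ^ α
  set U := HalfSkew.upsilon α (τ / (√2 * √v))
  calc (2 * Real.pi)⁻¹ * (v ^ α * (√2 * √v * (B * U)))
      = (2 * Real.pi)⁻¹ * (√2 * B) * (√v * v ^ α * U) := by ring
    _ = _ := by rw [e]; field_simp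

theorem integral_parabola {α v : ℝ} (hα : 0 < α) (hv : 0 < v) :
    (2 * Real.pi)⁻¹ * ∫ t, parabola α v t = HalfSkew.constI α * v ^ (1 / 2 + α) := by
  have hs : 0 < √(2 * v) := by positivity
  simp_rw [parabola_eq hv]
  rw [integral_const_mul, Measure.integral_comp_mul_left fun s : ℝ => max (1 - s ^ 2) 0 ^ α,
    inv_inv, abs_of_pos hs, smul_eq_mul, integral_bump hα, Real.sqrt_mul zero_le_two,
    Real.rpow_add hv, ← Real.sqrt_eq_rpow]
  have e := sqrt_two_mul_integral_eq hα
  set B := ∫ s in (-1 : ℝ)..1, (1 - s ^ 2) ^ α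
  calc (2 * Real.pi)⁻¹ * (v ^ α * (√2 * √v * B))
      = (2 * Real.pi)⁻¹ * (√2 * B) * (√v * v ^ α) := by ring
    _ = _ := by rw [e]; field_simp

theorem continuous_parabola {α : ℝ} (hα : 0 < α) (v : ℝ) : Continuous (parabola α v) :=
  (by fun_prop : Continuous fun t : ℝ => max (v - t ^ 2 / 2) 0).rpow_const
    fun _ => Or.inr hα.le

theorem integrable_parabola {α : ℝ} (hα : 0 < α) (v : ℝ) : Integrable (parabola α v) := by
  refine (continuous_parabola hα v).integrable_of_hasCompactSupport
    (HasCompactSupport.intro (isCompact_Icc (a := -√(2 * v)) (b := √(2 * v))) fun t ht => ?_)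
  rw [parabola, max_eq_right, Real.zero_rpow hα.ne']
  by_contra! h
  exact ht (abs_le.1 (Real.abs_le_sqrt (by linarith)))

theorem parabola_mono {α v w s t : ℝ} (hα : 0 < α) (h : v - s ^ 2 / 2 ≤ w - t ^ 2 / 2) :
    parabola α v s ≤ parabola α w t :=
  Real.rpow_le_rpow (le_max_right _ _) (max_le_max_right _ h) hα.le

/-- Reflection `t ↦ c - t` and evenness of the profile. -/
theorem setIntegral_Ioi_parabola_sub (α w c τ : ℝ) :
    ∫ t in Set.Ioi τ, parabola α w (t - c) = ∫ t in Set.Iic (c - τ), parabola α w t := by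
  rw [integral_Iic_eq_integral_Iio, ← integral_indicator measurableSet_Ioi,
    ← integral_indicator measurableSet_Iio, ← integral_sub_left_eq_self _ volume c]
  congr 1
  ext t
  have hmem : c - t ∈ Set.Ioi τ ↔ t ∈ Set.Iio (c - τ) := by
    rw [Set.mem_Ioi, Set.mem_Iio, lt_sub_comm]
  have heven : parabola α w (c - t - c) = parabola α w t := by
    simp [parabola]
  simp only [Set.indicator_apply, hmem, heven]

/-- The difference of the two quadratics is affine in `t`. For `λ > 0` it changes sign only at `τ =
λ + (y - x) / (2λ)`: the `x` profile dominates to the left, the `y` profile to the right. For `λ =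
0` they share a centre and one dominates everywhere; equality accounts for the value `1/2`. -/
theorem integral_max_parabola {α lam x y : ℝ} (hα : 0 < α) (hlam : 0 ≤ lam)
    (hx : x < 0) (hy : y < 0) :
    (2 * Real.pi)⁻¹ * ∫ t, max (parabola α |x| (t - 0)) (parabola α |y| (t - 2 * lam)) =
      HalfSkew.constI α * (|x| ^ (1 / 2 + α) * HalfSkew.upsilonTerm α lam x y +
        |y| ^ (1 / 2 + α) * HalfSkew.upsilonTerm α lam y x) := by
  have hx' : 0 < |x| := abs_pos.2 hx.ne
  have hy' : 0 < |y| := abs_pos.2 hy.ne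
  simp only [sub_zero]
  rcases hlam.eq_or_lt with rfl | hpos
  · simp only [mul_zero, sub_zero, HalfSkew.upsilonTerm, if_true]
    rcases lt_trichotomy x y with h | rfl | h
    · have hle : |y| ≤ |x| := by rw [abs_of_neg hx, abs_of_neg hy]; linarith
      have hm : ∀ t, max (parabola α |x| t) (parabola α |y| t) = parabola α |x| t := fun t =>
        max_eq_left (parabola_mono hα (by linarith))
      simp_rw [hm]
      rw [integral_parabola hα hx', if_pos h, if_neg h.not_gt, if_pos h]
      ring
    · simp_rw [max_self]
      rw [integral_parabola hα hx', if_neg (lt_irrefl _), if_neg (lt_irrefl _)]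
      ring
    · have hle : |x| ≤ |y| := by rw [abs_of_neg hx, abs_of_neg hy]; linarith
      have hm : ∀ t, max (parabola α |x| t) (parabola α |y| t) = parabola α |y| t := fun t =>
        max_eq_right (parabola_mono hα (by linarith))
      simp_rw [hm]
      rw [integral_parabola hα hy', if_pos h, if_neg h.not_gt, if_pos h]
      ring
  set τ := lam + (y - x) / (2 * lam) with hτ
  have hτ' : 2 * lam * τ = 2 * lam ^ 2 + (y - x) := by
    rw [hτ]; field_simp
  have hint : Integrable fun t => max (parabola α |x| t) (parabola α |y| (t - 2 * lam)) :=
    (integrable_parabola hα _).sup ((integrable_parabola hα _).comp_sub_right _)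
  have h1 : ∫ t in Set.Iic τ, max (parabola α |x| t) (parabola α |y| (t - 2 * lam)) =
      ∫ t in Set.Iic τ, parabola α |x| t := by
    refine setIntegral_congr_fun measurableSet_Iic fun t ht => max_eq_left ?_
    refine parabola_mono hα ?_
    have : 2 * lam * t ≤ 2 * lam * τ := mul_le_mul_of_nonneg_left ht (by positivity)
    rw [abs_of_neg hx, abs_of_neg hy]
    linarith [show (t - 2 * lam) ^ 2 / 2 = t ^ 2 / 2 - 2 * lam * t + 2 * lam ^ 2 by ring]
  have h2 : ∫ t in Set.Ioi τ, max (parabola α |x| t) (parabola α |y| (t - 2 * lam)) =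
      ∫ t in Set.Ioi τ, parabola α |y| (t - 2 * lam) := by
    refine setIntegral_congr_fun measurableSet_Ioi fun t ht => max_eq_right ?_
    refine parabola_mono hα ?_
    have : 2 * lam * τ ≤ 2 * lam * t := mul_le_mul_of_nonneg_left (le_of_lt ht) (by positivity)
    rw [abs_of_neg hx, abs_of_neg hy]
    linarith [show (t - 2 * lam) ^ 2 / 2 = t ^ 2 / 2 - 2 * lam * t + 2 * lam ^ 2 by ring]
  have h3 : 2 * lam - τ = lam + (x - y) / (2 * lam) := by
    rw [hτ]; ring
  rw [← intervalIntegral.integral_Iic_add_Ioi hint.integrableOn hint.integrableOn (b := τ),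
    h1, h2, setIntegral_Ioi_parabola_sub, mul_add, setIntegral_Iic_parabola hα hx',
    setIntegral_Iic_parabola hα hy', h3, HalfSkew.upsilonTerm, HalfSkew.upsilonTerm,
    if_neg hpos.ne', if_neg hpos.ne', mul_add]

/-! ### Assembly of both limits. -/

theorem abs_arccos_le {ρ : ℝ} (h : 0 < ρ) : |Real.arccos ρ| ≤ Real.pi / 2 := by
  rw [abs_of_nonneg (Real.arccos_nonneg _)]
  exact Real.arccos_le_pi_div_two.2 h.le

/-- The integrated tail of the skew component alone. -/
theorem tendsto_integral_cosTail {μ : Measure ℝ} [IsProbabilityMeasure μ] {α : ℝ}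
    (hα : 0 < α) (hμ : WeibullLaw μ α) {u ψ : ℕ → ℝ} {v τ : ℝ}
    (hv : 0 < v) (hu : Tendsto u atTop (𝓝[>] 0))
    (hψ' : ∀ᶠ n in atTop, |ψ n| ≤ Real.pi / 2)
    (hψ : Tendsto (fun n => ψ n / √(u n)) atTop (𝓝 τ)) :
    Tendsto (fun n => (2 * Real.pi)⁻¹ * ((∫ θ in -(Real.pi / 2)..Real.pi / 2,
        cosTail μ (1 - u n * v) (θ - ψ n)) / (√(u n) * μ.real (Set.Ioi (1 - u n)))))
      atTop (𝓝 (HalfSkew.constI α * v ^ (1 / 2 + α))) := by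
  -- The single-tail case is the maximum of a tail with itself.
  have := (tendsto_integral_max_cosTail hα hμ hv hv hu hψ' hψ hψ' hψ).const_mul (2 * Real.pi)⁻¹
  simp only [max_self] at this
  rwa [integral_sub_right_eq_self (parabola α v), integral_parabola hα hv] at this

theorem HalfSkew.IsHalfSkewArray.measureReal_iSup_le {Ω Ω' : Type*} [MeasurableSpace Ω]
    [MeasurableSpace Ω'] {P : Measure Ω} [IsProbabilityMeasure P] {Q : Measure Ω'}
    {X Y : Ω → ℝ} {Xa Za : (n : ℕ) → Fin n → Ω' → ℝ} {ρ : ℕ → ℝ}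
    (h : HalfSkew.IsHalfSkewArray Xa Za Q X Y P ρ) {n : ℕ} (hn : 1 ≤ n) {u : ℝ} (hu : 0 < u)
    (x y : ℝ) :
    Q.real {ω | ((⨆ j : Fin n, Xa n j ω) - 1) / u ≤ x ∧ ((⨆ j : Fin n, Za n j ω) - 1) / u ≤ y} =
      (1 + -P.real {ω | 1 + u * x < X ω ∨ 1 + u * y < HalfSkew.skew (ρ n) (X ω) (Y ω)}) ^ n := by
  have : Nonempty (Fin n) := ⟨⟨0, hn⟩⟩
  have hE : MeasurableSet {p : ℝ × ℝ | p.1 ≤ 1 + u * x ∧ p.2 ≤ 1 + u * y} :=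
    (measurableSet_le measurable_fst measurable_const).inter
      (measurableSet_le measurable_snd measurable_const)
  have scale : ∀ (f : Fin n → ℝ) (z : ℝ), ((⨆ j, f j) - 1) / u ≤ z ↔ ∀ j, f j ≤ 1 + u * z := by
    intro f z
    rw [div_le_iff₀ hu, ← ciSup_le_iff (Set.finite_range f).bddAbove]
    constructor <;> intro h <;> linarith
  have hset : {ω | ((⨆ j : Fin n, Xa n j ω) - 1) / u ≤ x ∧
      ((⨆ j : Fin n, Za n j ω) - 1) / u ≤ y} = ⋂ j ∈ (Finset.univ : Finset (Fin n)),
        (fun ω => (Xa n j ω, Za n j ω)) ⁻¹' {p : ℝ × ℝ | p.1 ≤ 1 + u * x ∧ p.2 ≤ 1 + u * y} := by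
    ext ω
    simp only [Set.mem_ofPred_eq, scale, Finset.mem_univ, Set.iInter_true, Set.mem_iInter,
      Set.mem_preimage, forall_and]
  have hcompl : (fun ω => (X ω, HalfSkew.skew (ρ n) (X ω) (Y ω))) ⁻¹'
        {p : ℝ × ℝ | p.1 ≤ 1 + u * x ∧ p.2 ≤ 1 + u * y} =
      {ω | 1 + u * x < X ω ∨ 1 + u * y < HalfSkew.skew (ρ n) (X ω) (Y ω)}ᶜ := by
    ext ω
    simp
  -- Only almost-everywhere measurability is available, through the identity of laws with an array
  -- entry.
  have hnull : NullMeasurableSet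
      {ω | 1 + u * x < X ω ∨ 1 + u * y < HalfSkew.skew (ρ n) (X ω) (Y ω)} P := by
    rw [← compl_compl {ω | 1 + u * x < X ω ∨ 1 + u * y < HalfSkew.skew (ρ n) (X ω) (Y ω)},
      ← hcompl]
    exact ((h.identDistrib n ⟨0, hn⟩).aemeasurable_snd.nullMeasurable hE).compl
  rw [hset, measureReal_def, (h.indep n).measure_inter_preimage_eq_mul _ fun _ _ => hE]
  simp_rw [(h.identDistrib n _).measure_mem_eq hE]
  rw [Finset.prod_const, Finset.card_univ, Fintype.card_fin, ENNReal.toReal_pow, hcompl,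
    ← measureReal_def, probReal_compl_eq_one_sub₀ hnull, sub_eq_add_neg]

theorem theorem2p2
    {Ω Ω' : Type*} [MeasurableSpace Ω] [MeasurableSpace Ω']
    (P : Measure Ω) [IsProbabilityMeasure P] (P' : Measure Ω') [IsProbabilityMeasure P']
    (X Y : Ω → ℝ) (R Θ : Ω' → ℝ) (hXY : HalfSkew.IsPolarPair X Y P R Θ P')
    (F : ℝ → ℝ) (hF : F = fun x => cdf (P'.map R) x)
    (α : ℝ) (hα : 0 < α) (hMDA : HalfSkew.IsWeibullMDA F α)
    (ρ u : ℕ → ℝ) (hρ : ∀ n, 1 ≤ n → 0 < ρ n ∧ ρ n ≤ 1)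
    (hu_pos : ∀ n, 1 ≤ n → 0 < u n) (hu : Tendsto u atTop (𝓝 0))
    (lam : ℝ) (hlam : 0 ≤ lam)
    (hlim : Tendsto (fun n => (1 - ρ n) / u n) atTop (𝓝 (2 * lam ^ 2))) :
    (∀ x : ℝ, x < 0 →
      Tendsto (fun n => P.real {ω | HalfSkew.skew (ρ n) (X ω) (Y ω) > 1 + u n * x} /
          (√(u n) * (1 - F (1 - u n))))
        atTop (𝓝 (2 * HalfSkew.constI α * |x| ^ (1 / 2 + α)))) ∧
    (∀ {Ω'' : Type*} [MeasurableSpace Ω''] (Q : Measure Ω'') [IsProbabilityMeasure Q]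
      (Xa Za : (n : ℕ) → Fin n → Ω'' → ℝ),
      HalfSkew.IsHalfSkewArray Xa Za Q X Y P ρ →
      (fun n : ℕ => √(u n) * (1 - F (1 - u n))) ~[atTop] (fun n : ℕ => 1 / (n : ℝ)) →
      ∀ x y : ℝ, x < 0 → y < 0 →
        Tendsto (fun n : ℕ => Q.real {ω |
            ((⨆ j : Fin n, Xa n j ω) - 1) / u n ≤ x ∧ ((⨆ j : Fin n, Za n j ω) - 1) / u n ≤ y})
          atTop (𝓝 (HalfSkew.limitDF α lam x y))) := by
  have hu' : Tendsto u atTop (𝓝[>] 0) := tendsto_nhdsWithin_iff.2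
    ⟨hu, eventually_atTop.2 ⟨1, hu_pos⟩⟩
  have hρ' : ∀ᶠ n in atTop, 0 < ρ n ∧ ρ n ≤ 1 := eventually_atTop.2 ⟨1, hρ⟩
  subst hF
  obtain ⟨hμ, hF⟩ := weibullLaw_map hXY.aemeasurable_radius hXY.radius_pos hMDA
  have : IsProbabilityMeasure (P'.map R) :=
    Measure.isProbabilityMeasure_map hXY.aemeasurable_radius
  have hψ := tendsto_arccos_div_sqrt hlam hu' hρ' hlim
  have hψ' : ∀ᶠ n in atTop, |Real.arccos (ρ n)| ≤ Real.pi / 2 :=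
    hρ'.mono fun n hn => abs_arccos_le hn.1
  have level : ∀ x : ℝ, x < 0 → ∀ n, 1 + u n * x = 1 - u n * |x| := fun x hx n => by
    rw [abs_of_neg hx]; ring
  have level_nonneg : ∀ x : ℝ, ∀ᶠ n in atTop, 0 ≤ 1 + u n * x := fun x => by
    have : Tendsto (fun n => 1 + u n * x) atTop (𝓝 1) := by
      simpa using (hu.mul_const x).const_add 1
    exact (this.eventually_const_lt zero_lt_one).mono fun _ h => h.le
  simp only [hF]
  refine ⟨fun x hx => ?_, fun Q _ Xa Za hXZ hnorm x y hx hy => ?_⟩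
  · have hlimit := (tendsto_integral_cosTail hα hμ (abs_pos.2 hx.ne) hu' hψ' hψ).const_mul 2
    rw [← mul_assoc] at hlimit
    refine hlimit.congr' ?_
    filter_upwards [hρ'] with n hn
    simp only [gt_iff_lt]
    rw [HalfSkew.IsPolarPair.measureReal_skew_gt hXY hμ hn.1 hn.2, level x hx]
    ring
  · have hzero : Tendsto (fun n => (0 : ℝ) / √(u n)) atTop (𝓝 0) := by simp
    have hx' := abs_pos.2 hx.ne
    have hy' := abs_pos.2 hy.ne
    -- Right half-plane, with unshifted `X` direction, plus left half-plane.
    have hsum := ((tendsto_integral_max_cosTail hα hμ hx' hy' hu'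
      (ψ₁ := fun _ => 0) (Eventually.of_forall fun _ => by simpa using (half_pos Real.pi_pos).le)
      hzero hψ' hψ).const_mul (2 * Real.pi)⁻¹).add
        (tendsto_integral_cosTail hα hμ hy' hu' hψ' hψ)
    rw [integral_max_parabola hα hlam hx hy] at hsum
    -- The normalisation converts the tail asymptotics into the limit of `n` times the exceedance
    -- probability, as the exponential limit requires.
    have hone : Tendsto (fun n : ℕ =>
        n * (√(u n) * (P'.map R).real (Set.Ioi (1 - u n)))) atTop (𝓝 1) := by
      have h0 : ∀ᶠ n : ℕ in atTop, 1 / (n : ℝ) ≠ 0 := by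
        filter_upwards [eventually_ge_atTop 1] with n hn
        have : (0 : ℝ) < n := by exact_mod_cast hn
        positivity
      refine ((isEquivalent_iff_tendsto_one h0).1 hnorm).congr fun n => ?_
      rw [Pi.div_apply, div_div_eq_mul_div, div_one, mul_comm]
    have hprob := hone.mul hsum
    rw [one_mul] at hprob
    have hexp := Real.tendsto_one_add_pow_exp_of_tendsto (g := fun n =>
      -P.real {ω | 1 + u n * x < X ω ∨ 1 + u n * y < HalfSkew.skew (ρ n) (X ω) (Y ω)})
      (t := -(HalfSkew.constI α * (|x| ^ (1 / 2 + α) * HalfSkew.upsilonTerm α lam x y +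
        |y| ^ (1 / 2 + α) * (1 + HalfSkew.upsilonTerm α lam y x)))) (by
      have := hprob.neg
      rw [show HalfSkew.constI α * (|x| ^ (1 / 2 + α) * HalfSkew.upsilonTerm α lam x y +
        |y| ^ (1 / 2 + α) * (1 + HalfSkew.upsilonTerm α lam y x)) =
        HalfSkew.constI α * (|x| ^ (1 / 2 + α) * HalfSkew.upsilonTerm α lam x y +
        |y| ^ (1 / 2 + α) * HalfSkew.upsilonTerm α lam y x) +
        HalfSkew.constI α * |y| ^ (1 / 2 + α) by ring]
      refine this.congr' ?_
      filter_upwards [hρ', level_nonneg x, level_nonneg y, eventually_ge_atTop 1]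
        with n hn h1 h2 hn1
      have hu0 := hu_pos n hn1
      have htail := hμ.tail_pos (u n) hu0
      rw [HalfSkew.IsPolarPair.measureReal_gt_or_skew_gt hXY hμ hn.1 hn.2 h1 h2, level x hx, level y hy]
      have hs := Real.sqrt_pos.2 hu0
      field_simp)
    refine hexp.congr' ?_
    filter_upwards [eventually_ge_atTop 1] with n hn
    exact (HalfSkew.IsHalfSkewArray.measureReal_iSup_le hXZ hn (hu_pos n hn) x y).symm
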